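/- Let $K$ be a field and let $A$ be a finite-dimensional $K$-algebra that is connected and basic (the regular module has no direct summand $P\oplus P$ with $P$ indecomposable projective). Modules are right modules, and $J$ denotes the Jacobson radical of $A$. Assume that $A$ is a Nakayama algebra, that is, every finitely generated indecomposable projective left or right $A$-module is uniserial, and that $A$ is not selfinjective. Let $n$ be the number of isomorphism classes of simple $A$-modules. Suppose that there is a simple $A$-module $S$ of infinite projective dimension and that every simple $A$-module not isomorphic to $S$ has projective dimension one. A Kupisch series of $A$ is a sequence $[c_1,\dots,c_n]$ of the form $c_i=\operatorname{length}(e_iA)$, where $e_1,\dots,e_n$ are primitive orthogonal idempotents with $e_1+\dots+e_n=1$, ordered so that there are projective covers $e_iA\to e_{i-1}J$ for $2\le i\le n$ and a projective cover $e_1A\to e_nJ$. Then there are integers $k,q$, with either $2\le k\le n$ and $q\ge 1$, or $k=n+1$ and $q\ge 0$, such that $$[k+qn,\;k+n-1+qn,\;k+n-2+qn,\;\dots,\;k+2+qn,\;k+1+qn]$$ (with first entry $k+qn$ and $i$-th entry $k+n-i+1+qn$ for $2\le i\le n$) is a Kupisch series of $A$, and every Kupisch series of $A$ is a cyclic permutation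 of it. -/

import Mathlib

/-! Right `A`-modules are modules over `Aᵐᵒᵖ`. In particular `Submodule Aᵐᵒᵖ A` is the lattice of
right ideals of `A`, and `Module.length Aᵐᵒᵖ` is the composition length of a right module. -/

universe u v

namespace NakayamaKupisch

/-- A module is uniserial if its submodules are totally ordered by inclusion. -/
def IsUniserial (R M : Type u) [Ring R] [AddCommGroup M] [Module R M] : Prop :=
  ∀ N N' : Submodule R M, N ≤ N' ∨ N' ≤ N

/-- A module is indecomposable if it is nonzero and is not the internal direct sum of two nonzero
submodules. -/
def IsIndecomposable (R M : Type u) [Ring R] [AddCommGroup M] [Module R M] : Prop :=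
  Nontrivial M ∧ ∀ N N' : Submodule R M, IsCompl N N' → N = ⊥ ∨ N' = ⊥

/-- Every finitely generated indecomposable projective (left) `R`-module is uniserial. -/
def HasUniserialProjectives (R : Type u) [Ring R] : Prop :=
  ∀ (P : Type u) [AddCommGroup P] [Module R P] [Module.Finite R P] [Module.Projective R P],
    IsIndecomposable R P → IsUniserial R P

/-- Nakayama rings: every finitely generated indecomposable projective left or right module is
uniserial. -/
def IsNakayama (A : Type u) [Ring A] : Prop :=
  HasUniserialProjectives A ∧ HasUniserialProjectives Aᵐᵒᵖ

/-- A ring is connected if it is nonzero and is not a product of two nonzero rings, that is, `0`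
and `1` are its only central idempotents. -/
def IsConnectedRing (A : Type u) [Ring A] : Prop :=
  Nontrivial A ∧ ∀ z : A, IsIdempotentElem z → (∀ a : A, z * a = a * z) → z = 0 ∨ z = 1

/-- `A` is basic: the regular right module has no direct summand of the form `P × P` with `P`
indecomposable (such a `P` is automatically projective). -/
def IsBasic (A : Type u) [Ring A] : Prop :=
  ∀ (P Q : Type u) [AddCommGroup P] [Module Aᵐᵒᵖ P] [AddCommGroup Q] [Module Aᵐᵒᵖ Q],
    IsIndecomposable Aᵐᵒᵖ P → IsEmpty (A ≃ₗ[Aᵐᵒᵖ] (P × P) × Q)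

/-- `A` is selfinjective: the regular right module is injective. -/
def IsSelfinjective (A : Type u) [Ring A] : Prop :=
  Module.Injective Aᵐᵒᵖ A

/-- Two maximal right ideals `I`, `I'` are related if the simple right modules `A / I` and `A / I'`
are isomorphic. -/
def simpleSetoid (A : Type u) [Ring A] : Setoid {I : Submodule Aᵐᵒᵖ A // IsCoatom I} where
  r I I' := Nonempty ((A ⧸ I.1) ≃ₗ[Aᵐᵒᵖ] (A ⧸ I'.1))
  iseqv := ⟨fun _ => ⟨LinearEquiv.refl _ _⟩, fun ⟨f⟩ => ⟨f.symm⟩, fun ⟨f⟩ ⟨g⟩ => ⟨f.trans g⟩⟩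

/-- The number of isomorphism classes of simple right `A`-modules; every simple right module is
isomorphic to `A / I` for some maximal right ideal `I`. -/
noncomputable def numSimples (A : Type u) [Ring A] : ℕ :=
  Nat.card (Quotient (simpleSetoid A))

/-- The projective dimension of a right `A`-module; it is `⊤` if there is no finite projective
resolution. -/
noncomputable def projDim (A M : Type u) [Ring A] [AddCommGroup M] [Module Aᵐᵒᵖ M] : WithBot ℕ∞ :=
  CategoryTheory.projectiveDimension (ModuleCat.of Aᵐᵒᵖ M)

/-- A primitive idempotent: a nonzero idempotent that is not the sum of two nonzero orthogonal
idempotents. -/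
def IsPrimitiveIdempotent {A : Type u} [Ring A] (e : A) : Prop :=
  IsIdempotentElem e ∧ e ≠ 0 ∧
    ∀ f g : A, IsIdempotentElem f → IsIdempotentElem g → f * g = 0 → g * f = 0 → f + g = e →
      f = 0 ∨ g = 0

/-- The right ideal `eA`. -/
def idemIdeal {A : Type u} [Ring A] (e : A) : Submodule Aᵐᵒᵖ A :=
  LinearMap.range (LinearMap.mulLeft Aᵐᵒᵖ e)

/-- The right ideal `eJ`, where `J` is the Jacobson radical of `A`, the intersection of all maximal
right ideals. -/
def idemRad {A : Type u} [Ring A] (e : A) : Submodule Aᵐᵒᵖ A :=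
  (Module.jacobson Aᵐᵒᵖ A).map (LinearMap.mulLeft Aᵐᵒᵖ e)

/-- A projective cover: a surjection from a projective module with superfluous kernel. -/
def IsProjectiveCover {R P M : Type u} [Ring R] [AddCommGroup P] [AddCommGroup M] [Module R P]
    [Module R M] (f : P →ₗ[R] M) : Prop :=
  Module.Projective R P ∧ Function.Surjective f ∧
    ∀ N : Submodule R P, N ⊔ LinearMap.ker f = ⊤ → N = ⊤

/-- A cyclic ordering `e₁, …, eₙ` (indexed by `Fin n`, whose addition is modulo `n`) of a complete
set of primitive orthogonal idempotents such that there are projective covers `eᵢ₊₁A → eᵢJ` for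
`i < n`, and `e₁A → eₙJ`. -/
structure IsKupischOrdering (A : Type u) [Ring A] {n : ℕ} [NeZero n] (e : Fin n → A) : Prop where
  complete : CompleteOrthogonalIdempotents e
  primitive : ∀ i, IsPrimitiveIdempotent (e i)
  cover : ∀ i, ∃ f : idemIdeal (e (i + 1)) →ₗ[Aᵐᵒᵖ] idemRad (e i), IsProjectiveCover f

/-- `[c₁, …, cₙ]` is a Kupisch series of `A`: `cᵢ` is the length of `eᵢA` for an ordering
`e₁, …, eₙ` as above. -/
def IsKupischSeries (A : Type u) [Ring A] {n : ℕ} [NeZero n] (c : Fin n → ℕ) : Prop :=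
  ∃ e : Fin n → A, IsKupischOrdering A e ∧ ∀ i, Module.length Aᵐᵒᵖ (idemIdeal (e i)) = c i

/-- The sequence `[k + qn, k + n - 1 + qn, k + n - 2 + qn, …, k + 1 + qn]`. The entry at position
`i + 1` is at the index `i` of `Fin n`. -/
def standardSeries (n k q : ℕ) (i : Fin n) : ℕ :=
  if (i : ℕ) = 0 then k + q * n else k + (n - (i : ℕ)) + q * n

end NakayamaKupisch

/-! Write `P i` for the uniserial right projective `e i A`, `c i` for its length, and `s` for the
index with top `S`; basicness makes the `P i` pairwise nonisomorphic. If `i ≠ s`, the top of `P i`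
has projective dimension exactly one, so the radical of `P i` is projective and nonzero. Being
covered by `P (i + 1)`, it is isomorphic to it, and `c (i + 1) = c i - 1`. Going once around the
cycle gives `c (s + 1) = c s + n - 1`, so the whole series is determined by `c s`.

The bound `n + 1 ≤ c s` comes from the infinite projective dimension of `S`
(`IsKupischOrdering.exists_length_eq`). The second syzygy of `S` is the kernel of `P (s + 1) → rad
(P s)`, of length `c (s + 1) - (c s - 1) = n`. The submodules of `P (s + 1)` of length at least `c
s` are all projective (`projective_of_length_le`), since they occur among `P (s + 1) ⊃ P (s + 2) ⊃ ⋯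
⊃ P s`. Hence `c s ≤ n` would bound the projective dimension of `S` by two.

A Kupisch ordering exists because the map `σ` sending `i` to the index of the cover of `rad (P i)`
is a single cycle (`exists_isKupischOrdering`). Uniseriality of the left projectives makes `σ`
injective (`not_range_eq_jacobson`), and lengths fall along `σ` until `s` is reached, so every orbit
contains `s`. Any two orderings have isomorphic projectives over `S`, hence the same `c s`, hence
the same series up to rotation. -/

namespace NakayamaKupisch
open CategoryTheory

/-! ### Uniserial modules and their projective covers. -/

section Uniserial

variable {R P Q T : Type u} [Ring R] [AddCommGroup P] [Module R P] [AddCommGroup Q] [Module R Q]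
  [AddCommGroup T] [Module R T]

theorem IsUniserial.le_jacobson (h : IsUniserial R P) [Module.Finite R P] {N : Submodule R P}
    (hN : N ≠ ⊤) : N ≤ Module.jacobson R P := by
  refine le_sInf fun I hI => ?_
  rcases h N I with h1 | h1
  · exact h1
  · rcases hI.le_iff.1 h1 with h2 | h2
    · exact absurd h2 hN
    · exact h2.le

theorem jacobson_ne_top [Module.Finite R P] [Nontrivial P] : Module.jacobson R P ≠ ⊤ :=
  (Module.jacobson_lt_top R P).ne

theorem IsUniserial.isCoatom_jacobson (h : IsUniserial R P) [Module.Finite R P] [Nontrivial P] :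
    IsCoatom (Module.jacobson R P) :=
  ⟨jacobson_ne_top, fun N hN => by
    by_contra hc
    exact absurd (h.le_jacobson hc) hN.not_ge⟩

theorem IsUniserial.eq_top_of_sup_eq_top (h : IsUniserial R P) {N N' : Submodule R P}
    (hN' : N' ≠ ⊤) (hs : N ⊔ N' = ⊤) : N = ⊤ := by
  rcases h N N' with h1 | h1
  · rw [sup_eq_right.2 h1] at hs
    exact absurd hs hN'
  · rwa [sup_eq_left.2 h1] at hs

/-- The surjection splits, so the kernel and the image of the section are comparable and meet in
zero; the image is nonzero, so the kernel vanishes. -/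
theorem IsUniserial.injective_of_surjective (h : IsUniserial R P) [Module.Projective R Q]
    [Nontrivial Q] {f : P →ₗ[R] Q} (hf : Function.Surjective f) : Function.Injective f := by
  obtain ⟨g, hg⟩ := Module.projective_lifting_property f LinearMap.id hf
  have hg' : ∀ x, f (g x) = x := fun x => LinearMap.congr_fun hg x
  rw [← LinearMap.ker_eq_bot, eq_bot_iff]
  rcases h (LinearMap.ker f) (LinearMap.range g) with h1 | h1
  · intro x hx
    obtain ⟨y, rfl⟩ := h1 hx
    have : y = 0 := by rw [← hg' y]; exact hx
    simp [this]
  · obtain ⟨y, hy⟩ := exists_ne (0 : Q)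
    refine absurd ?_ hy
    rw [← hg' y]
    exact h1 ⟨y, rfl⟩

/-- The proper submodule `ker g` is superfluous in a uniserial module, and `range f` together with
it spans `Q`. -/
theorem IsUniserial.surjective_of_comp (h : IsUniserial R Q) {f : P →ₗ[R] Q} {g : Q →ₗ[R] T}
    [Nontrivial T] (hfg : Function.Surjective (g ∘ₗ f)) : Function.Surjective f := by
  rw [← LinearMap.range_eq_top]
  have hg : LinearMap.ker g ≠ ⊤ := by
    intro hk
    obtain ⟨y, hy⟩ := exists_ne (0 : T)
    obtain ⟨x, hx⟩ := hfg y
    apply hy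
    rw [← hx]
    have : f x ∈ LinearMap.ker g := hk ▸ Submodule.mem_top
    exact this
  refine h.eq_top_of_sup_eq_top hg (eq_top_iff.2 fun y _ => ?_)
  obtain ⟨x, hx⟩ := hfg (g y)
  rw [← add_sub_cancel (f x) y]
  refine Submodule.add_mem_sup ⟨x, rfl⟩ ?_
  simpa [sub_eq_zero] using hx.symm

/-- Uniqueness of projective covers: a lift of one surjection through the other is onto, hence also
injective. Mostly used with `T` simple, to identify projectives with a common top. -/
theorem IsUniserial.nonempty_equiv (hP : IsUniserial R P) (hQ : IsUniserial R Q)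
    [Module.Projective R P] [Module.Projective R Q] [Nontrivial T]
    {f : P →ₗ[R] T} (hf : Function.Surjective f) {g : Q →ₗ[R] T} (hg : Function.Surjective g) :
    Nonempty (P ≃ₗ[R] Q) := by
  obtain ⟨k, hk⟩ := Module.projective_lifting_property g f hg
  have : Nontrivial Q := hg.nontrivial
  have hks : Function.Surjective k := hQ.surjective_of_comp (g := g) (by rw [hk]; exact hf)
  exact ⟨LinearEquiv.ofBijective k ⟨hP.injective_of_surjective hks, hks⟩⟩

theorem IsUniserial.ker_eq_jacobson (hP : IsUniserial R P) [Module.Finite R P]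
    [IsSimpleModule R T] {f : P →ₗ[R] T} (hf : Function.Surjective f) :
    LinearMap.ker f = Module.jacobson R P := by
  have hc : IsCoatom (LinearMap.ker f) := by
    rw [← isSimpleModule_iff_isCoatom]
    exact IsSimpleModule.congr (f.quotKerEquivOfSurjective hf)
  exact le_antisymm (hP.le_jacobson hc.1) (sInf_le hc)

theorem length_jacobson_add_one (hP : IsUniserial R P) [Module.Finite R P] [Nontrivial P] :
    Module.length R (Module.jacobson R P) + 1 = Module.length R P := by
  have : IsSimpleModule R (P ⧸ Module.jacobson R P) :=
    isSimpleModule_iff_isCoatom.2 hP.isCoatom_jacobson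
  rw [← Module.length_eq_one R (P ⧸ Module.jacobson R P)]
  exact (Module.length_eq_add_of_exact (Module.jacobson R P).subtype
    (Module.jacobson R P).mkQ (Submodule.injective_subtype _) (Submodule.mkQ_surjective _)
    (LinearMap.exact_subtype_mkQ _)).symm

end Uniserial

/-! ### Syzygies and projective dimension. -/

section ProjDim

variable {A P Q T M : Type u} [Ring A] [AddCommGroup P] [Module Aᵐᵒᵖ P] [AddCommGroup Q]
  [Module Aᵐᵒᵖ Q] [AddCommGroup T] [Module Aᵐᵒᵖ T] [AddCommGroup M] [Module Aᵐᵒᵖ M]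

theorem hasProjectiveDimensionLT_succ_iff_ker [Module.Projective Aᵐᵒᵖ P] {f : P →ₗ[Aᵐᵒᵖ] T}
    (hf : Function.Surjective f) (m : ℕ) :
    HasProjectiveDimensionLT (ModuleCat.of Aᵐᵒᵖ T) (m + 2) ↔
      HasProjectiveDimensionLT (ModuleCat.of Aᵐᵒᵖ (LinearMap.ker f)) (m + 1) := by
  let X : ShortComplex (ModuleCat.{u} Aᵐᵒᵖ) :=
    ShortComplex.mk (ModuleCat.ofHom (LinearMap.ker f).subtype) (ModuleCat.ofHom f)
      (by ext x; exact x.2)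
  have hX : X.ShortExact := 
    { exact := by
        rw [ShortComplex.moduleCat_exact_iff]
        intro x hx
        exact ⟨⟨x, hx⟩, rfl⟩
      mono_f := (ModuleCat.mono_iff_injective _).2 (Submodule.injective_subtype _)
      epi_g := (ModuleCat.epi_iff_surjective _).2 hf }
  exact hX.hasProjectiveDimensionLT_X₃_iff m
    (inferInstanceAs (Projective (ModuleCat.of Aᵐᵒᵖ P)))

theorem hasProjectiveDimensionLT_one_iff :
    HasProjectiveDimensionLT (ModuleCat.of Aᵐᵒᵖ M) 1 ↔ Module.Projective Aᵐᵒᵖ M := by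
  rw [← projective_iff_hasProjectiveDimensionLT_one, ← IsProjective.iff_projective]

theorem projective_ker_of_projDim_eq_one (h : projDim A T = 1) [Module.Projective Aᵐᵒᵖ P]
    {f : P →ₗ[Aᵐᵒᵖ] T} (hf : Function.Surjective f) :
    Module.Projective Aᵐᵒᵖ (LinearMap.ker f) := by
  rw [← hasProjectiveDimensionLT_one_iff, ← hasProjectiveDimensionLT_succ_iff_ker hf 0]
  exact (projectiveDimension_le_iff _ 1).1 h.le

theorem not_hasProjectiveDimensionLT_of_projDim_eq_top (h : projDim A T = ⊤) (m : ℕ) :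
    ¬ HasProjectiveDimensionLT (ModuleCat.of Aᵐᵒᵖ T) m := by
  intro hm
  have := projectiveDimension_lt_iff.2 hm
  rw [projDim] at h
  rw [h] at this
  exact not_top_lt this

theorem not_projective_of_projDim_eq_top (h : projDim A T = ⊤) : ¬ Module.Projective Aᵐᵒᵖ T :=
  fun hp => not_hasProjectiveDimensionLT_of_projDim_eq_top h 1
    (hasProjectiveDimensionLT_one_iff.2 hp)

theorem not_projective_of_projDim_eq_one (h : projDim A T = 1) : ¬ Module.Projective Aᵐᵒᵖ T := by
  intro hp
  have := (projectiveDimension_le_iff _ 0).2 (hasProjectiveDimensionLT_one_iff.2 hp)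
  rw [projDim] at h
  rw [h] at this
  exact absurd this (by decide)

/-- Here `ker g` is a second syzygy of `T`; were it projective, `T` would have projective dimension
at most two. -/
theorem not_projective_ker_of_range_eq_ker (h : projDim A T = ⊤) [Module.Projective Aᵐᵒᵖ P]
    [Module.Projective Aᵐᵒᵖ Q] {f : P →ₗ[Aᵐᵒᵖ] T} (hf : Function.Surjective f)
    {g : Q →ₗ[Aᵐᵒᵖ] P} (hg : LinearMap.range g = LinearMap.ker f) :
    ¬ Module.Projective Aᵐᵒᵖ (LinearMap.ker g) := by
  intro hp
  refine not_hasProjectiveDimensionLT_of_projDim_eq_top h 3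
    ((hasProjectiveDimensionLT_succ_iff_ker hf 1).2 ?_)
  rw [← hg, hasProjectiveDimensionLT_succ_iff_ker g.surjective_rangeRestrict 0,
    hasProjectiveDimensionLT_one_iff, LinearMap.ker_rangeRestrict]
  exact hp

end ProjDim
end NakayamaKupisch

namespace NakayamaKupisch
open MulOpposite

/-! ### Primitive idempotents and the projectives they generate. -/

section Idempotents

variable {A : Type u} [Ring A] {e f : A}

theorem mem_idemIdeal (he : IsIdempotentElem e) {x : A} : x ∈ idemIdeal e ↔ e * x = x := by
  constructor
  · rintro ⟨y, rfl⟩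
    simp [← mul_assoc, he.eq]
  · intro h
    exact ⟨x, h⟩

theorem self_mem_idemIdeal (he : IsIdempotentElem e) : e ∈ idemIdeal e :=
  (mem_idemIdeal he).2 he

/-- The projection `A → eA`. -/
def idemProj (e : A) : A →ₗ[Aᵐᵒᵖ] idemIdeal e := (LinearMap.mulLeft Aᵐᵒᵖ e).rangeRestrict

@[simp] theorem coe_idemProj (x : A) : (idemProj e x : A) = e * x := rfl

theorem idemProj_surjective : Function.Surjective (idemProj e) :=
  LinearMap.surjective_rangeRestrict _

theorem idemProj_coe (he : IsIdempotentElem e) (x : idemIdeal e) : idemProj e (x : A) = x :=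
  Subtype.ext ((mem_idemIdeal he).1 x.2)

instance regular_projective : Module.Projective Aᵐᵒᵖ A :=
  Module.Projective.of_split
    ({ toFun := op, map_add' := fun _ _ => rfl, map_smul' := fun _ _ => rfl } : A →ₗ[Aᵐᵒᵖ] Aᵐᵒᵖ)
    { toFun := unop, map_add' := fun _ _ => rfl, map_smul' := fun _ _ => rfl } rfl

instance regular_finite : Module.Finite Aᵐᵒᵖ A :=
  ⟨⟨{1}, by
    rw [eq_top_iff]
    intro x _
    rw [Finset.coe_singleton, Submodule.mem_span_singleton]
    exact ⟨op x, by simp⟩⟩⟩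

theorem idemIdeal_projective (he : IsIdempotentElem e) : Module.Projective Aᵐᵒᵖ (idemIdeal e) :=
  Module.Projective.of_split (idemIdeal e).subtype (idemProj e)
    (LinearMap.ext fun x => idemProj_coe he x)

instance idemIdeal_finite : Module.Finite Aᵐᵒᵖ (idemIdeal e) :=
  Module.Finite.of_surjective _ (idemProj_surjective (e := e))

theorem IsPrimitiveIdempotent.nontrivial (he : IsPrimitiveIdempotent e) :
    Nontrivial (idemIdeal e) :=
  ⟨⟨⟨e, self_mem_idemIdeal he.1⟩, 0, fun h => he.2.1 (congrArg Subtype.val h)⟩⟩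

/-- The components of `e` in a decomposition of `eA` are orthogonal idempotents with sum `e`, so one
of them is zero and the other generates everything. -/
theorem IsPrimitiveIdempotent.isIndecomposable (he : IsPrimitiveIdempotent e) :
    IsIndecomposable Aᵐᵒᵖ (idemIdeal e) := by
  refine ⟨he.nontrivial, fun N N' h => ?_⟩
  obtain ⟨x, hx, y, hy, hxy⟩ := Submodule.mem_sup.1
    (h.sup_eq_top ▸ Submodule.mem_top : (⟨e, self_mem_idemIdeal he.1⟩ : idemIdeal e) ∈ N ⊔ N')
  have hxy' : (x : A) + y = e := congrArg Subtype.val hxy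
  have ex := (mem_idemIdeal he.1).1 x.2
  have ey := (mem_idemIdeal he.1).1 y.2
  have key : ∀ (a b : idemIdeal e) (L L' : Submodule Aᵐᵒᵖ (idemIdeal e)), a ∈ L → b ∈ L' →
      Disjoint L L' → (a : A) + b = e → e * (a : A) = a →
      IsIdempotentElem (a : A) ∧ (b : A) * a = 0 := by
    intro a b L L' ha hb hd hab hea
    -- Multiplying `a + b = e` on the right by `a` gives `a - a * a = b * a`, which lies in both
    -- summands and so is zero.
    have h1 : a - op (a : A) • a = op (a : A) • b := by
      apply Subtype.ext
      simp only [Submodule.coe_sub, Submodule.coe_smul, MulOpposite.smul_eq_mul_unop, unop_op]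
      rw [sub_eq_iff_eq_add, add_comm, ← add_mul, hab, hea]
    have h2 : a - op (a : A) • a = 0 := by
      have := (Submodule.mem_inf.2 ⟨L.sub_mem ha (L.smul_mem _ ha),
        h1 ▸ L'.smul_mem (op (a : A)) hb⟩ : a - op (a : A) • a ∈ L ⊓ L')
      rwa [hd.eq_bot] at this
    constructor
    · have := congrArg Subtype.val h2
      simp only [Submodule.coe_sub, Submodule.coe_smul, MulOpposite.smul_eq_mul_unop, unop_op,
        Submodule.coe_zero, sub_eq_zero] at this
      exact this.symm
    · rw [h2] at h1
      exact (congrArg Subtype.val h1).symm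
  obtain ⟨hix, hyx⟩ := key x y N N' hx hy h.disjoint hxy' ex
  obtain ⟨hiy, hxy0⟩ := key y x N' N hy hx h.disjoint.symm (by rw [add_comm, hxy']) ey
  have fin : ∀ (b : idemIdeal e) (L L' : Submodule Aᵐᵒᵖ (idemIdeal e)), b ∈ L' → Disjoint L L' →
      (b : A) = e → L = ⊥ := by
    intro b L L' hb hd hbe
    rw [eq_bot_iff, ← hd.eq_bot]
    refine le_inf le_rfl fun z _ => ?_
    have : z = op (z : A) • b := by
      apply Subtype.ext
      simp [hbe, (mem_idemIdeal he.1).1 z.2]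
    rw [this]
    exact L'.smul_mem _ hb
  rcases he.2.2 x y hix hiy hxy0 hyx hxy' with h0 | h0
  · exact Or.inl (fin y N N' hy h.disjoint (by simpa [h0] using hxy'))
  · exact Or.inr (fin x N' N hx h.disjoint.symm (by simpa [h0] using hxy'))

theorem IsPrimitiveIdempotent.isUniserial (he : IsPrimitiveIdempotent e)
    (h : HasUniserialProjectives Aᵐᵒᵖ) : IsUniserial Aᵐᵒᵖ (idemIdeal e) :=
  have := idemIdeal_projective he.1
  h _ he.isIndecomposable

/-- The left module `Ae` is uniserial, so any two of its elements are comparable by left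
divisibility. -/
theorem IsPrimitiveIdempotent.left_mul_comparable (he : IsPrimitiveIdempotent e)
    (h : HasUniserialProjectives A) {x y : A} (hx : x * e = x) (hy : y * e = y) :
    (∃ a, x = a * y) ∨ ∃ a, y = a * x := by
  let P : Submodule A A := LinearMap.range (LinearMap.mulRight A e)
  have memP : ∀ {z : A}, z ∈ P ↔ z * e = z := by
    intro z
    constructor
    · rintro ⟨y, rfl⟩
      simp [mul_assoc, he.1.eq]
    · intro h
      exact ⟨z, h⟩
  have eP : e ∈ P := memP.2 he.1
  have hproj : Module.Projective A P :=
    Module.Projective.of_split P.subtype (LinearMap.mulRight A e).rangeRestrict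
      (LinearMap.ext fun x => Subtype.ext (memP.1 x.2))
  have hfin : Module.Finite A P :=
    Module.Finite.of_surjective _ (LinearMap.mulRight A e).surjective_rangeRestrict
  -- The mirror image, for `Ae`, of the argument for `eA`.
  have hind : IsIndecomposable A P := by
    refine ⟨⟨⟨⟨e, eP⟩, 0, fun h => he.2.1 (congrArg Subtype.val h)⟩⟩, fun N N' h => ?_⟩
    obtain ⟨x, hx, y, hy, hxy⟩ := Submodule.mem_sup.1
      (h.sup_eq_top ▸ Submodule.mem_top : (⟨e, eP⟩ : P) ∈ N ⊔ N')
    have hxy' : (x : A) + y = e := congrArg Subtype.val hxy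
    have key : ∀ (a b : P) (L L' : Submodule A P), a ∈ L → b ∈ L' →
        Disjoint L L' → (a : A) + b = e → IsIdempotentElem (a : A) ∧ (a : A) * b = 0 := by
      intro a b L L' ha hb hd hab
      have h1 : a - (a : A) • a = (a : A) • b := by
        apply Subtype.ext
        simp only [Submodule.coe_sub, Submodule.coe_smul, smul_eq_mul]
        rw [sub_eq_iff_eq_add, add_comm, ← mul_add, hab, memP.1 a.2]
      have h2 : a - (a : A) • a = 0 := by
        have := (Submodule.mem_inf.2 ⟨L.sub_mem ha (L.smul_mem _ ha),
          h1 ▸ L'.smul_mem (a : A) hb⟩ : a - (a : A) • a ∈ L ⊓ L')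
        rwa [hd.eq_bot] at this
      constructor
      · have := congrArg Subtype.val h2
        simp only [Submodule.coe_sub, Submodule.coe_smul, smul_eq_mul,
          Submodule.coe_zero, sub_eq_zero] at this
        exact this.symm
      · rw [h2] at h1
        exact (congrArg Subtype.val h1).symm
    obtain ⟨hix, hxy0⟩ := key x y N N' hx hy h.disjoint hxy'
    obtain ⟨hiy, hyx⟩ := key y x N' N hy hx h.disjoint.symm (by rw [add_comm, hxy'])
    have fin : ∀ (b : P) (L L' : Submodule A P), b ∈ L' → Disjoint L L' →
        (b : A) = e → L = ⊥ := by
      intro b L L' hb hd hbe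
      rw [eq_bot_iff, ← hd.eq_bot]
      refine le_inf le_rfl fun z _ => ?_
      have : z = (z : A) • b := by
        apply Subtype.ext
        simp [hbe, memP.1 z.2]
      rw [this]
      exact L'.smul_mem _ hb
    rcases he.2.2 x y hix hiy hxy0 hyx hxy' with h0 | h0
    · exact Or.inl (fin y N N' hy h.disjoint (by simpa [h0] using hxy'))
    · exact Or.inr (fin x N' N hx h.disjoint.symm (by simpa [h0] using hxy'))
  have comp : ∀ {a b : A} (ha : a * e = a) (hb : b * e = b),
      Submodule.span A {(⟨a, memP.2 ha⟩ : P)} ≤ Submodule.span A {(⟨b, memP.2 hb⟩ : P)} →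
      ∃ c, a = c * b := by
    intro a b ha hb hab
    obtain ⟨c, hc⟩ := Submodule.mem_span_singleton.1 (hab (Submodule.mem_span_singleton_self _))
    exact ⟨c, (congrArg Subtype.val hc).symm⟩
  exact (h P hind _ _).imp (comp hx hy) (comp hy hx)

/-- With `g = 1 - e - f` there is a Peirce decomposition `A ≅ (eA × fA) × gA`; an isomorphism `eA ≅
fA` would produce a repeated summand. -/
theorem isEmpty_equiv_of_orthogonal (h : IsBasic A) (he : IsPrimitiveIdempotent e)
    (hf : IsPrimitiveIdempotent f) (hef : e * f = 0) (hfe : f * e = 0) :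
    IsEmpty (idemIdeal e ≃ₗ[Aᵐᵒᵖ] idemIdeal f) := by
  refine ⟨fun φ => ?_⟩
  let g : A := 1 - e - f
  have heg : e * g = 0 := by simp [g, mul_sub, he.1.eq, hef]
  have hfg : f * g = 0 := by simp [g, mul_sub, hf.1.eq, hfe]
  have hge : g * e = 0 := by simp [g, sub_mul, he.1.eq, hfe]
  have hgf : g * f = 0 := by simp [g, sub_mul, hf.1.eq, hef]
  have hg : IsIdempotentElem g := by
    have : g * g = g * (1 - e - f) := rfl
    rw [IsIdempotentElem, this, mul_sub, mul_sub, hge, hgf, mul_one, sub_zero, sub_zero]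
  let ψ : A ≃ₗ[Aᵐᵒᵖ] (idemIdeal e × idemIdeal f) × idemIdeal g :=
    LinearEquiv.ofLinearMap (((idemProj e).prod (idemProj f)).prod (idemProj g))
      (((idemIdeal e).subtype.coprod (idemIdeal f).subtype).coprod (idemIdeal g).subtype)
      (by
        apply LinearMap.ext
        rintro ⟨⟨x, y⟩, z⟩
        have hx := (mem_idemIdeal he.1).1 x.2
        have hy := (mem_idemIdeal hf.1).1 y.2
        have hz := (mem_idemIdeal hg).1 z.2
        have o : ∀ {a b c : A}, a * b = 0 → b * c = c → a * c = 0 := by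
          intro a b c hab hbc
          rw [← hbc, ← mul_assoc, hab, zero_mul]
        ext <;> simp [hx, hy, hz, o hef hy, o heg hz, o hfe hx, o hfg hz, o hge hx,
          o hgf hy])
      (by
        apply LinearMap.ext
        intro x
        simp [g, sub_mul])
  exact (h _ _ he.isIndecomposable).false
    (ψ.trans (((LinearEquiv.refl _ _).prodCongr φ.symm).prodCongr (LinearEquiv.refl _ _)))

/-- For `m ≠ 0` in `T`, the map `a ↦ m a` sends `1 = ∑ e i` to `m`, so it is nonzero on some `e i
A`, hence onto `T` by simplicity. -/
theorem exists_surjective_of_complete {ι : Type*} [Fintype ι] {e : ι → A} (he : ∑ i, e i = 1)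
    (T : Type u) [AddCommGroup T] [Module Aᵐᵒᵖ T] [IsSimpleModule Aᵐᵒᵖ T] :
    ∃ i, ∃ g : idemIdeal (e i) →ₗ[Aᵐᵒᵖ] T, Function.Surjective g := by
  have : Nontrivial T := IsSimpleModule.nontrivial Aᵐᵒᵖ T
  obtain ⟨m, hm⟩ := exists_ne (0 : T)
  let φ : A →ₗ[Aᵐᵒᵖ] T :=
    { toFun := fun a => op a • m
      map_add' := fun a b => by rw [op_add, add_smul]
      map_smul' := fun a b => by simp [mul_smul] }
  by_contra! hc
  apply hm
  have h1 : φ 1 = m := by simp [φ]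
  rw [← h1, ← he, map_sum]
  refine Finset.sum_eq_zero fun i _ => ?_
  have h2 : φ ∘ₗ LinearMap.mulLeft Aᵐᵒᵖ (e i) = 0 := by
    have h3 : φ ∘ₗ (idemIdeal (e i)).subtype = 0 :=
      (LinearMap.surjective_or_eq_zero _).resolve_left (hc i _)
    ext
    exact LinearMap.congr_fun h3 (idemProj (e i) 1)
  simpa using LinearMap.congr_fun h2 1

theorem map_subtype_jacobson_idemIdeal (he : IsIdempotentElem e) :
    (Module.jacobson Aᵐᵒᵖ (idemIdeal e)).map (idemIdeal e).subtype = idemRad e := by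
  apply le_antisymm
  · rintro _ ⟨x, hx, rfl⟩
    exact ⟨x, Module.map_jacobson_le (idemIdeal e).subtype ⟨x, hx, rfl⟩,
      (mem_idemIdeal he).1 x.2⟩
  · rintro _ ⟨x, hx, rfl⟩
    exact ⟨idemProj e x, Module.map_jacobson_le (idemProj e) ⟨x, hx, rfl⟩, rfl⟩

end Idempotents

/-- Induction on the dimension of `eA`: if `e` is neither zero nor primitive, it splits as `f + g`
with `fA` and `gA` strictly smaller. -/
theorem exists_orthogonal_primitive {K : Type v} {A : Type u} [Field K] [Ring A] [Algebra K A]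
    [FiniteDimensional K A] (e : A) (he : IsIdempotentElem e) :
    ∃ s : Finset A, (∀ x ∈ s, IsPrimitiveIdempotent x) ∧
      (∀ x ∈ s, ∀ y ∈ s, x ≠ y → x * y = 0) ∧ ∑ x ∈ s, x = e := by
  classical
  induction hm : Module.finrank K (LinearMap.range (LinearMap.mulLeft K e)) using
    Nat.strong_induction_on generalizing e with
  | _ m ih =>
    by_cases h0 : e = 0
    · exact ⟨∅, by simp, by simp, by simp [h0]⟩
    by_cases hp : IsPrimitiveIdempotent e
    · refine ⟨{e}, by simpa using hp, ?_, by simp⟩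
      intro x hx y hy hxy
      simp only [Finset.mem_singleton] at hx hy
      exact absurd (hx.trans hy.symm) hxy
    obtain ⟨f, g, hf, hg, hfg, hgf, hfge, hf0, hg0⟩ : ∃ f g : A, IsIdempotentElem f ∧
        IsIdempotentElem g ∧ f * g = 0 ∧ g * f = 0 ∧ f + g = e ∧ f ≠ 0 ∧ g ≠ 0 := by
      by_contra! hc
      refine hp ⟨he, h0, fun f g hf hg hfg hgf h => ?_⟩
      by_contra! h'
      exact h'.2 (hc f g hf hg hfg hgf h h'.1)
    have lt : ∀ a b : A, IsIdempotentElem b → a * b = 0 → b * a = 0 → a + b = e → b ≠ 0 →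
        Module.finrank K (LinearMap.range (LinearMap.mulLeft K a)) < m := by
      intro a b hb hab hba habe hb0
      rw [← hm]
      apply Submodule.finrank_lt_finrank_of_lt
      refine lt_of_le_of_ne ?_ ?_
      · rintro _ ⟨x, rfl⟩
        -- Idempotency of `a` is automatic: expanding `(a + b) * (a + b) = a + b` leaves `a * a + b
        -- = a + b`.
        by_cases haa : a * a = a
        · exact ⟨a * x, by simp [← habe, add_mul, ← mul_assoc, hba, haa]⟩
        · refine absurd ?_ haa
          have h1 := he.eq
          rw [← habe, add_mul, mul_add, mul_add, hab, hba, hb.eq] at h1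
          simpa using h1
      · intro h
        have hbm : b ∈ LinearMap.range (LinearMap.mulLeft K e) :=
          ⟨b, by simp [← habe, add_mul, hab, hb.eq]⟩
        rw [← h] at hbm
        obtain ⟨x, hx⟩ := hbm
        apply hb0
        rw [← hb.eq]
        nth_rw 2 [← hx]
        simp [← mul_assoc, hba]
    obtain ⟨s, hs, hso, hse⟩ := ih _ (lt f g hg hfg hgf hfge hg0) f hf rfl
    obtain ⟨t, ht, hto, hte⟩ := ih _ (lt g f hf hgf hfg (by rw [add_comm, hfge]) hf0) g hg rfl
    have fixL : ∀ {s : Finset A} {f : A}, (∀ x ∈ s, IsPrimitiveIdempotent x) →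
        (∀ x ∈ s, ∀ y ∈ s, x ≠ y → x * y = 0) → ∑ x ∈ s, x = f →
        ∀ x ∈ s, f * x = x ∧ x * f = x := by
      intro s f hs hso hse x hx
      rw [← hse, Finset.sum_mul, Finset.mul_sum, Finset.sum_eq_single_of_mem x hx,
        Finset.sum_eq_single_of_mem x hx]
      · exact ⟨(hs x hx).1, (hs x hx).1⟩
      · exact fun y hy hyx => hso x hx y hy hyx.symm
      · exact fun y hy hyx => hso y hy x hx hyx
    have hst : ∀ x ∈ s, ∀ y ∈ t, x * y = 0 ∧ y * x = 0 := by
      intro x hx y hy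
      obtain ⟨h1, h2⟩ := fixL hs hso hse x hx
      obtain ⟨h3, h4⟩ := fixL ht hto hte y hy
      constructor
      · rw [← h2, ← h3, mul_assoc, ← mul_assoc f, hfg, zero_mul, mul_zero]
      · rw [← h4, ← h1, mul_assoc, ← mul_assoc g, hgf, zero_mul, mul_zero]
    have hd : Disjoint s t := by
      rw [Finset.disjoint_left]
      intro x hx hx'
      apply (hs x hx).2.1
      rw [← (hs x hx).1.eq]
      exact (hst x hx x hx').1
    refine ⟨s ∪ t, ?_, ?_, by rw [Finset.sum_union hd, hse, hte, hfge]⟩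
    · intro x hx
      rcases Finset.mem_union.1 hx with h | h
      exacts [hs x h, ht x h]
    · intro x hx y hy hxy
      rcases Finset.mem_union.1 hx with h | h <;> rcases Finset.mem_union.1 hy with h' | h'
      exacts [hso x h y h' hxy, (hst x h y h').1, (hst y h' x h).2, hto x h y h' hxy]

end NakayamaKupisch

namespace NakayamaKupisch

/-! ### Combinatorics of sequences on a cycle. -/

section Counting

/-- Between `s + 1` and the return to `s` there are `n - 1` steps, each lowering `c` by one. -/
theorem add_eq_of_forall_ne {n : ℕ} [NeZero n] {c : Fin n → ℕ} {s : Fin n}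
    (h : ∀ i, i ≠ s → c (i + 1) + 1 = c i) :
    c (s + 1) + 1 = c s + n ∧ ∀ i : Fin n, i ≠ 0 → c (i + s) + i = c s + n := by
  have hn : 0 < n := Nat.pos_of_ne_zero (NeZero.ne n)
  -- `Fin.ofNat` reduces modulo `n`, so `j + 1 = n` is the return to `s`.
  have key : ∀ j, j + 1 ≤ n → c (s + Fin.ofNat n (j + 1)) + (j + 1) = c (s + 1) + 1 := by
    intro j
    induction j with
    | zero => intro _; rfl
    | succ j ih =>
      intro hj
      have hne : s + Fin.ofNat n (j + 1) ≠ s := by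
        intro h0
        have h1 : Fin.ofNat n (j + 1) = 0 := by simpa using h0
        have h2 := congrArg Fin.val h1
        simp only [Fin.val_ofNat, Fin.val_zero] at h2
        rw [Nat.mod_eq_of_lt (by omega)] at h2
        omega
      have h1 := h _ hne
      have h2 : s + Fin.ofNat n (j + 1) + 1 = s + Fin.ofNat n (j + 1 + 1) := by
        rw [add_assoc]
        congr 1
        ext
        simp [Fin.val_add]
      rw [h2] at h1
      have := ih (by omega)
      omega
  have hlast : c (s + 1) + 1 = c s + n := by
    have h1 := key (n - 1) (by omega)
    have h2 : Fin.ofNat n (n - 1 + 1) = 0 := by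
      ext
      simp [Nat.sub_add_cancel hn]
    rw [h2, add_zero] at h1
    omega
  refine ⟨hlast, fun i hi => ?_⟩
  have hi0 : (i : ℕ) ≠ 0 := fun h0 => hi (Fin.ext (by simpa using h0))
  have h1 := key (i - 1) (by omega)
  have h2 : Fin.ofNat n ((i : ℕ) - 1 + 1) = i := by
    ext
    rw [Fin.val_ofNat, Nat.mod_eq_of_lt (by omega)]
    omega
  rw [h2, add_comm s i] at h1
  omega

theorem eq_standardSeries {n : ℕ} [NeZero n] {c : Fin n → ℕ} {s : Fin n}
    (h : ∀ i, i ≠ s → c (i + 1) + 1 = c i) {k q : ℕ} (hk : c s = k + q * n) (i : Fin n) :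
    c (i + s) = standardSeries n k q i := by
  by_cases hi : i = 0
  · simp [standardSeries, hi, hk]
  · have h1 := (add_eq_of_forall_ne h).2 i hi
    have hi0 : (i : ℕ) ≠ 0 := fun h0 => hi (Fin.ext (by simpa using h0))
    rw [standardSeries, if_neg hi0]
    omega

theorem exists_standard_parameters {n : ℕ} (hn : n ≠ 0) {m : ℕ} (hm : n + 1 ≤ m) :
    ∃ k q : ℕ, ((2 ≤ k ∧ k ≤ n ∧ 1 ≤ q) ∨ k = n + 1) ∧ m = k + q * n := by
  have h1 := Nat.mod_add_div' (m - 2) n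
  have h2 := Nat.mod_lt (m - 2) (Nat.pos_of_ne_zero hn)
  -- Dividing `m - 2` rather than `m` puts `k` in the range from `2` to `n + 1`; if `k ≤ n`, then `q
  -- = 0` would contradict `n + 1 ≤ m`.
  refine ⟨(m - 2) % n + 2, (m - 2) / n, ?_, by omega⟩
  by_cases h3 : (m - 2) % n + 2 = n + 1
  · exact Or.inr h3
  · refine Or.inl ⟨by omega, by omega, Nat.one_le_iff_ne_zero.2 fun h4 => ?_⟩
    rw [h4, zero_mul] at h1
    omega

/-- Every orbit contains `s`, so `σ` is one cycle, enumerated by `i ↦ (σ ^ i) s`. -/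
theorem exists_fin_equiv_of_reach {ι : Type*} [Fintype ι] (σ : Equiv.Perm ι) (s : ι)
    (h : ∀ i, ∃ m : ℕ, (σ ^ m) i = s) (n : ℕ) [NeZero n] (hn : Fintype.card ι = n) :
    ∃ φ : Fin n ≃ ι, ∀ i, φ (i + 1) = σ (φ i) := by
  have hs : ∀ i, σ.SameCycle i s := fun i => by
    obtain ⟨m, hm⟩ := h i
    exact ⟨m, by simpa using hm⟩
  have hc : σ.IsCycleOn ((Finset.univ : Finset ι) : Set ι) := by
    refine ⟨by simp, fun x _ y _ => ?_⟩
    exact (hs x).trans (hs y).symm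
  let φ : Fin n → ι := fun i => (σ ^ (i : ℕ)) s
  have hφ : Function.Surjective φ := by
    intro x
    obtain ⟨m, hm, hx⟩ := hc.exists_pow_eq (Finset.mem_univ s) (Finset.mem_univ x)
    rw [Finset.card_univ, hn] at hm
    exact ⟨⟨m, hm⟩, hx⟩
  refine ⟨Equiv.ofBijective φ ((Fintype.bijective_iff_surjective_and_card φ).2
    ⟨hφ, by simp [hn]⟩), fun i => ?_⟩
  change (σ ^ ((i + 1 : Fin n) : ℕ)) s = σ ((σ ^ (i : ℕ)) s)
  rw [← Equiv.Perm.mul_apply, ← pow_succ', hc.pow_apply_eq_pow_apply (Finset.mem_univ s),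
    Finset.card_univ, hn]
  simp [Nat.ModEq, Fin.val_add]

end Counting

/-! ### Radicals of indecomposable projectives. -/

section Simple

variable {A S P Q : Type u} [Ring A] [AddCommGroup S] [Module Aᵐᵒᵖ S]
  [AddCommGroup P] [Module Aᵐᵒᵖ P] [AddCommGroup Q] [Module Aᵐᵒᵖ Q]

/-- The top of `P` is a simple module other than `S`, so it has projective dimension one, and the
radical is its first syzygy. -/
theorem jacobson_projective [Module.Finite Aᵐᵒᵖ P] [Module.Projective Aᵐᵒᵖ P] [Nontrivial P]
    (hT : ∀ (T : Type u) [AddCommGroup T] [Module Aᵐᵒᵖ T] [IsSimpleModule Aᵐᵒᵖ T],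
      IsEmpty (T ≃ₗ[Aᵐᵒᵖ] S) → projDim A T = 1)
    (hP : IsUniserial Aᵐᵒᵖ P) (h : ∀ f : P →ₗ[Aᵐᵒᵖ] S, ¬ Function.Surjective f) :
    Module.Projective Aᵐᵒᵖ (Module.jacobson Aᵐᵒᵖ P) := by
  have : IsSimpleModule Aᵐᵒᵖ (P ⧸ Module.jacobson Aᵐᵒᵖ P) :=
    isSimpleModule_iff_isCoatom.2 hP.isCoatom_jacobson
  have h1 := projective_ker_of_projDim_eq_one
    (hT (P ⧸ Module.jacobson Aᵐᵒᵖ P) ⟨fun φ => h (φ.toLinearMap ∘ₗ Submodule.mkQ _)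
      (φ.surjective.comp (Submodule.mkQ_surjective _))⟩) (Submodule.mkQ_surjective _)
  rwa [Submodule.ker_mkQ] at h1

/-- Otherwise `P` would be simple and projective, while no simple module has projective dimension
zero. -/
theorem jacobson_ne_bot [IsSimpleModule Aᵐᵒᵖ S] [Module.Finite Aᵐᵒᵖ P]
    [Module.Projective Aᵐᵒᵖ P] [Nontrivial P] (hS : projDim A S = ⊤)
    (hT : ∀ (T : Type u) [AddCommGroup T] [Module Aᵐᵒᵖ T] [IsSimpleModule Aᵐᵒᵖ T],
      IsEmpty (T ≃ₗ[Aᵐᵒᵖ] S) → projDim A T = 1)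
    (hP : IsUniserial Aᵐᵒᵖ P) : Module.jacobson Aᵐᵒᵖ P ≠ ⊥ := by
  intro h0
  have key : ∀ (T : Type u) [AddCommGroup T] [Module Aᵐᵒᵖ T] [IsSimpleModule Aᵐᵒᵖ T]
      (f : P →ₗ[Aᵐᵒᵖ] T), Function.Surjective f → Module.Projective Aᵐᵒᵖ T := by
    intro T _ _ _ f hf
    have hk : LinearMap.ker f = ⊥ := by rw [hP.ker_eq_jacobson hf, h0]
    exact Module.Projective.of_equiv
      (LinearEquiv.ofBijective f ⟨LinearMap.ker_eq_bot.1 hk, hf⟩)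
  by_cases h : ∃ f : P →ₗ[Aᵐᵒᵖ] S, Function.Surjective f
  · obtain ⟨f, hf⟩ := h
    exact not_projective_of_projDim_eq_top hS (key S f hf)
  · push Not at h
    have : IsSimpleModule Aᵐᵒᵖ (P ⧸ Module.jacobson Aᵐᵒᵖ P) :=
      isSimpleModule_iff_isCoatom.2 hP.isCoatom_jacobson
    exact not_projective_of_projDim_eq_one
      (hT (P ⧸ Module.jacobson Aᵐᵒᵖ P) ⟨fun φ => h (φ.toLinearMap ∘ₗ Submodule.mkQ _)
        (φ.surjective.comp (Submodule.mkQ_surjective _))⟩)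
      (key _ _ (Submodule.mkQ_surjective _))

theorem exists_equiv_jacobson (hQ : IsUniserial Aᵐᵒᵖ Q)
    [Module.Projective Aᵐᵒᵖ (Module.jacobson Aᵐᵒᵖ P)] (h0 : Module.jacobson Aᵐᵒᵖ P ≠ ⊥)
    {g : Q →ₗ[Aᵐᵒᵖ] P} (hg : LinearMap.range g = Module.jacobson Aᵐᵒᵖ P) :
    Nonempty (Q ≃ₗ[Aᵐᵒᵖ] Module.jacobson Aᵐᵒᵖ P) := by
  have : Nontrivial (Module.jacobson Aᵐᵒᵖ P) := Submodule.nontrivial_iff_ne_bot.2 h0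
  have hs : Function.Surjective
      ((LinearEquiv.ofEq _ _ hg).toLinearMap ∘ₗ g.rangeRestrict) :=
    (LinearEquiv.ofEq _ _ hg).surjective.comp g.surjective_rangeRestrict
  exact ⟨LinearEquiv.ofBijective _ ⟨hQ.injective_of_surjective hs, hs⟩⟩

end Simple

/-! ### Long submodules are projective. -/

section Family

variable {A : Type u} [Ring A] [IsArtinianRing Aᵐᵒᵖ]

/-- Induction on the length of `P i`. A proper `N` that is at least as long as `P s` forces `i ≠ s`,
and it lies in the radical of `P i`, which is isomorphic to the shorter module `P (σ i)`. -/
theorem projective_of_length_le {ι : Type*} {P : ι → Type u} [∀ i, AddCommGroup (P i)]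
    [∀ i, Module Aᵐᵒᵖ (P i)] [∀ i, Module.Finite Aᵐᵒᵖ (P i)]
    [∀ i, Module.Projective Aᵐᵒᵖ (P i)] (hP : ∀ i, IsUniserial Aᵐᵒᵖ (P i)) (σ : ι → ι) (s : ι)
    (hσ : ∀ i, i ≠ s → Nonempty (P (σ i) ≃ₗ[Aᵐᵒᵖ] Module.jacobson Aᵐᵒᵖ (P i)))
    (i : ι) (N : Submodule Aᵐᵒᵖ (P i))
    (hN : Module.length Aᵐᵒᵖ (P s) ≤ Module.length Aᵐᵒᵖ N) : Module.Projective Aᵐᵒᵖ N := by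
  induction hm : Module.length Aᵐᵒᵖ (P i) using WellFoundedLT.induction generalizing i with
  | ind m ih =>
    by_cases ht : N = ⊤
    · subst ht
      exact Module.Projective.of_equiv Submodule.topEquiv.symm
    have hlt := Submodule.length_lt ht
    have his : i ≠ s := by
      rintro rfl
      exact absurd hN hlt.not_ge
    obtain ⟨φ⟩ := hσ i his
    have hle := (hP i).le_jacobson ht
    have hjac : Module.jacobson Aᵐᵒᵖ (P i) ≠ ⊤ := by
      intro h
      have : Nontrivial (P i) := by
        by_contra hc
        rw [not_nontrivial_iff_subsingleton] at hc
        exact ht (Subsingleton.elim _ _)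
      exact jacobson_ne_top h
    let ψ : N →ₗ[Aᵐᵒᵖ] P (σ i) := φ.symm.toLinearMap ∘ₗ Submodule.inclusion hle
    have hψ : Function.Injective ψ := φ.symm.injective.comp (Submodule.inclusion_injective hle)
    let θ : N ≃ₗ[Aᵐᵒᵖ] LinearMap.range ψ := LinearEquiv.ofInjective ψ hψ
    have := ih (Module.length Aᵐᵒᵖ (P (σ i)))
      (by rw [φ.length_eq, ← hm]; exact Submodule.length_lt hjac)
      (σ i) (LinearMap.range ψ) (by rwa [← θ.length_eq]) rfl
    exact Module.Projective.of_equiv θ.symm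

end Family

/-! ### Lengths along a Kupisch ordering. -/

section Ordering

variable {A : Type u} [Ring A] {n : ℕ} [NeZero n] {e : Fin n → A}

theorem idemRad_le_idemIdeal (e : A) : idemRad e ≤ idemIdeal e := by
  rintro _ ⟨x, _, rfl⟩
  exact ⟨x, rfl⟩

theorem exists_range_eq_jacobson {e f : A} (he : IsIdempotentElem e)
    {p : idemIdeal f →ₗ[Aᵐᵒᵖ] idemRad e} (hp : Function.Surjective p) :
    ∃ g : idemIdeal f →ₗ[Aᵐᵒᵖ] idemIdeal e,
      LinearMap.range g = Module.jacobson Aᵐᵒᵖ (idemIdeal e) := by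
  refine ⟨Submodule.inclusion (idemRad_le_idemIdeal e) ∘ₗ p, ?_⟩
  apply Submodule.map_injective_of_injective (Submodule.injective_subtype (idemIdeal e))
  rw [map_subtype_jacobson_idemIdeal he, ← LinearMap.range_comp, ← LinearMap.comp_assoc,
    Submodule.subtype_comp_inclusion, LinearMap.range_comp, LinearMap.range_eq_top.2 hp,
    Submodule.map_top, Submodule.range_subtype]

theorem exists_isProjectiveCover {e f : A} (he : IsIdempotentElem e) (hf : IsIdempotentElem f)
    (hu : IsUniserial Aᵐᵒᵖ (idemIdeal f)) {g : idemIdeal f →ₗ[Aᵐᵒᵖ] idemIdeal e}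
    (hg : LinearMap.range g = Module.jacobson Aᵐᵒᵖ (idemIdeal e))
    (h0 : Module.jacobson Aᵐᵒᵖ (idemIdeal e) ≠ ⊥) :
    ∃ p : idemIdeal f →ₗ[Aᵐᵒᵖ] idemRad e, IsProjectiveCover p := by
  have hr : LinearMap.range ((idemIdeal e).subtype ∘ₗ g) = idemRad e := by
    rw [LinearMap.range_comp, hg, map_subtype_jacobson_idemIdeal he]
  have hm : ∀ x, ((idemIdeal e).subtype ∘ₗ g) x ∈ idemRad e := fun x => hr ▸ ⟨x, rfl⟩
  refine ⟨((idemIdeal e).subtype ∘ₗ g).codRestrict (idemRad e) hm, idemIdeal_projective hf, ?_,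
    fun N hN => hu.eq_top_of_sup_eq_top ?_ hN⟩
  · rintro ⟨y, hy⟩
    rw [← hr] at hy
    obtain ⟨x, hx⟩ := hy
    exact ⟨x, Subtype.ext hx⟩
  · rw [LinearMap.ker_codRestrict, LinearMap.ker_comp, Submodule.ker_subtype,
      ← LinearMap.ker, Ne, LinearMap.ker_eq_top]
    rintro rfl
    exact h0 (by rw [← hg, LinearMap.range_zero])

theorem IsKupischOrdering.add_right (h : IsKupischOrdering A e) (r : Fin n) :
    IsKupischOrdering A (fun i => e (i + r)) where
  complete :=
    { idem := fun i => h.complete.idem _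
      ortho := fun i j hij => h.complete.ortho (fun h' => hij (by simpa using h'))
      complete := by
        rw [← h.complete.complete]
        exact Equiv.sum_comp (Equiv.addRight r) e }
  primitive i := h.primitive _
  cover i := by
    have := h.cover (i + r)
    rwa [add_right_comm] at this

theorem IsKupischOrdering.exists_length_eq [IsArtinianRing Aᵐᵒᵖ] (h : IsKupischOrdering A e)
    {c : Fin n → ℕ} (hc : ∀ i, Module.length Aᵐᵒᵖ (idemIdeal (e i)) = c i)
    (hbasic : IsBasic A) (hnak : IsNakayama A) (S : Type u) [AddCommGroup S] [Module Aᵐᵒᵖ S]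
    [IsSimpleModule Aᵐᵒᵖ S] (hS : projDim A S = ⊤)
    (hT : ∀ (T : Type u) [AddCommGroup T] [Module Aᵐᵒᵖ T] [IsSimpleModule Aᵐᵒᵖ T],
      IsEmpty (T ≃ₗ[Aᵐᵒᵖ] S) → projDim A T = 1) :
    ∃ s, (∃ f : idemIdeal (e s) →ₗ[Aᵐᵒᵖ] S, Function.Surjective f) ∧ n + 1 ≤ c s ∧
      ∀ i, i ≠ s → c (i + 1) + 1 = c i := by
  have hu : ∀ i, IsUniserial Aᵐᵒᵖ (idemIdeal (e i)) := fun i => (h.primitive i).isUniserial hnak.2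
  have hproj : ∀ i, Module.Projective Aᵐᵒᵖ (idemIdeal (e i)) := fun i =>
    idemIdeal_projective (h.primitive i).1
  have hnt : ∀ i, Nontrivial (idemIdeal (e i)) := fun i => (h.primitive i).nontrivial
  have hSn : Nontrivial S := IsSimpleModule.nontrivial Aᵐᵒᵖ S
  have h0 : ∀ i, Module.jacobson Aᵐᵒᵖ (idemIdeal (e i)) ≠ ⊥ := fun i =>
    jacobson_ne_bot hS hT (hu i)
  have hg : ∀ i, ∃ g : idemIdeal (e (i + 1)) →ₗ[Aᵐᵒᵖ] idemIdeal (e i),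
      LinearMap.range g = Module.jacobson Aᵐᵒᵖ (idemIdeal (e i)) := fun i => by
    obtain ⟨p, hp⟩ := h.cover i
    exact exists_range_eq_jacobson (h.primitive i).1 hp.2.1
  obtain ⟨s, f, hf⟩ := exists_surjective_of_complete h.complete.complete S
  have hjac : ∀ i, i ≠ s → Nonempty (idemIdeal (e (i + 1)) ≃ₗ[Aᵐᵒᵖ]
      Module.jacobson Aᵐᵒᵖ (idemIdeal (e i))) := by
    intro i hi
    have : Module.Projective Aᵐᵒᵖ (Module.jacobson Aᵐᵒᵖ (idemIdeal (e i))) := by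
      refine jacobson_projective hT (hu i) fun f' hf' => ?_
      obtain ⟨φ⟩ := (hu i).nonempty_equiv (hu s) hf' hf
      exact (isEmpty_equiv_of_orthogonal hbasic (h.primitive i) (h.primitive s)
        (h.complete.ortho hi) (h.complete.ortho hi.symm)).false φ
    obtain ⟨g, hg⟩ := hg i
    exact exists_equiv_jacobson (hu _) (h0 i) hg
  have hsucc : ∀ i, i ≠ s → c (i + 1) + 1 = c i := by
    intro i hi
    obtain ⟨φ⟩ := hjac i hi
    have := length_jacobson_add_one (hu i)
    rw [← φ.length_eq, hc, hc] at this
    exact_mod_cast this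
  refine ⟨s, ⟨f, hf⟩, ?_, hsucc⟩
  -- If `c s ≤ n`, then `ker g`, a second syzygy of `S` of length `n`, is long enough inside `e (s +
  -- 1) A` to be projective.
  by_contra! hlt
  obtain ⟨g, hg⟩ := hg s
  refine not_projective_ker_of_range_eq_ker hS hf (g := g)
    (by rw [hg, (hu s).ker_eq_jacobson hf]) ?_
  refine projective_of_length_le hu (· + 1) s hjac (s + 1) (LinearMap.ker g) ?_
  have h1 : Module.length Aᵐᵒᵖ (idemIdeal (e (s + 1))) =
      Module.length Aᵐᵒᵖ (LinearMap.ker g) + Module.length Aᵐᵒᵖ (LinearMap.range g) :=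
    Module.length_eq_add_of_exact (LinearMap.ker g).subtype g.rangeRestrict
    (Submodule.injective_subtype _) g.surjective_rangeRestrict
    (by
      rw [LinearMap.exact_iff, LinearMap.ker_rangeRestrict, Submodule.range_subtype])
  have h2 := length_jacobson_add_one (hu s)
  have h3 := (add_eq_of_forall_ne hsucc).1
  rw [hg] at h1
  rw [hc] at h1 h2 ⊢
  have hk : Module.length Aᵐᵒᵖ (LinearMap.ker g) ≠ ⊤ := Module.length_ne_top
  have hj : Module.length Aᵐᵒᵖ (Module.jacobson Aᵐᵒᵖ (idemIdeal (e s))) ≠ ⊤ :=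
    Module.length_ne_top
  lift Module.length Aᵐᵒᵖ (LinearMap.ker g) to ℕ using hk with a
  lift Module.length Aᵐᵒᵖ (Module.jacobson Aᵐᵒᵖ (idemIdeal (e s))) to ℕ using hj with b
  norm_cast at h1 h2 ⊢
  omega

end Ordering
end NakayamaKupisch

namespace NakayamaKupisch
open MulOpposite

theorem IsUniserial.submodule {R P : Type u} [Ring R] [AddCommGroup P] [Module R P]
    (h : IsUniserial R P) (L : Submodule R P) : IsUniserial R L := by
  intro N N'
  have := h (N.map L.subtype) (N'.map L.subtype)
  rwa [Submodule.map_le_map_iff_of_injective L.injective_subtype,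
    Submodule.map_le_map_iff_of_injective L.injective_subtype] at this

/-! ### Existence of a Kupisch ordering. -/

section Quiver

variable {A : Type u} [Ring A]

/-- Some `e i A` maps onto a simple quotient of the radical; the lift to the radical is onto because
the radical is itself uniserial. -/
theorem exists_index_range_eq_jacobson [IsArtinianRing Aᵐᵒᵖ] {ι : Type*} [Fintype ι] {e : ι → A}
    (he : ∑ i, e i = 1) (hi : ∀ i, IsIdempotentElem (e i)) {P : Type u} [AddCommGroup P]
    [Module Aᵐᵒᵖ P] [Module.Finite Aᵐᵒᵖ P] (hP : IsUniserial Aᵐᵒᵖ P)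
    (h0 : Module.jacobson Aᵐᵒᵖ P ≠ ⊥) :
    ∃ i, ∃ g : idemIdeal (e i) →ₗ[Aᵐᵒᵖ] P, LinearMap.range g = Module.jacobson Aᵐᵒᵖ P := by
  have hJ : Nontrivial (Module.jacobson Aᵐᵒᵖ P) := Submodule.nontrivial_iff_ne_bot.2 h0
  obtain ⟨N, hN⟩ := IsCoatomic.exists_coatom (Submodule Aᵐᵒᵖ (Module.jacobson Aᵐᵒᵖ P))
  have : IsSimpleModule Aᵐᵒᵖ (Module.jacobson Aᵐᵒᵖ P ⧸ N) := isSimpleModule_iff_isCoatom.2 hN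
  have hnt := IsSimpleModule.nontrivial Aᵐᵒᵖ (Module.jacobson Aᵐᵒᵖ P ⧸ N)
  obtain ⟨i, f, hf⟩ := exists_surjective_of_complete he (Module.jacobson Aᵐᵒᵖ P ⧸ N)
  have := idemIdeal_projective (hi i)
  obtain ⟨k, hk⟩ := Module.projective_lifting_property N.mkQ f N.mkQ_surjective
  have hks : Function.Surjective k :=
    (hP.submodule _).surjective_of_comp (g := N.mkQ) (by rw [hk]; exact hf)
  refine ⟨i, (Module.jacobson Aᵐᵒᵖ P).subtype ∘ₗ k, ?_⟩
  rw [LinearMap.range_comp, LinearMap.range_eq_top.2 hks, Submodule.map_top,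
    Submodule.range_subtype]

/-- A homomorphism out of `fA` is left multiplication by the image of `f`, which turns
factorizations of maps into left divisibility in `A`. -/
theorem idemIdeal_hom_apply {f e : A} (hf : IsIdempotentElem f)
    (g : idemIdeal f →ₗ[Aᵐᵒᵖ] idemIdeal e) (z : idemIdeal f) :
    (g z : A) = g ⟨f, self_mem_idemIdeal hf⟩ * z := by
  have hz : z = op (z : A) • (⟨f, self_mem_idemIdeal hf⟩ : idemIdeal f) :=
    Subtype.ext ((mem_idemIdeal hf).1 z.2).symm
  conv_lhs => rw [hz, map_smul]
  rfl

/-- If `g₁` were `ψ ∘ g₂` with `ψ : e₂A → e₁A`, then `ψ`, not being onto, would land in the radical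
`range g₁` and lift to `β` with `g₁ ∘ β = ψ`. Then `g₁ ∘ β ∘ g₂ = g₁` would make `β ∘ g₂` onto `fA`,
although its image lies in the radical of `fA`. -/
theorem ne_mul_of_range_eq_jacobson {e₁ e₂ f : A} (he₁ : IsPrimitiveIdempotent e₁)
    (he₂ : IsPrimitiveIdempotent e₂) (hf : IsPrimitiveIdempotent f)
    (hnak : HasUniserialProjectives Aᵐᵒᵖ)
    (hne : IsEmpty (idemIdeal e₂ ≃ₗ[Aᵐᵒᵖ] idemIdeal e₁))
    {g₁ : idemIdeal f →ₗ[Aᵐᵒᵖ] idemIdeal e₁} {g₂ : idemIdeal f →ₗ[Aᵐᵒᵖ] idemIdeal e₂}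
    (hg₁ : LinearMap.range g₁ = Module.jacobson Aᵐᵒᵖ (idemIdeal e₁))
    (hg₂ : LinearMap.range g₂ = Module.jacobson Aᵐᵒᵖ (idemIdeal e₂))
    (h0 : Module.jacobson Aᵐᵒᵖ (idemIdeal e₁) ≠ ⊥) (a : A) :
    (g₁ ⟨f, self_mem_idemIdeal hf.1⟩ : A) ≠ a * g₂ ⟨f, self_mem_idemIdeal hf.1⟩ := by
  intro ha
  have hu₁ := he₁.isUniserial hnak
  have hu₂ := he₂.isUniserial hnak
  have huf := hf.isUniserial hnak
  have := idemIdeal_projective he₁.1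
  have := idemIdeal_projective he₂.1
  have := he₁.nontrivial
  have := hf.nontrivial
  let ψ : idemIdeal e₂ →ₗ[Aᵐᵒᵖ] idemIdeal e₁ :=
    idemProj e₁ ∘ₗ LinearMap.mulLeft Aᵐᵒᵖ a ∘ₗ (idemIdeal e₂).subtype
  have hψ : ψ ∘ₗ g₂ = g₁ := by
    ext z
    change e₁ * (a * (g₂ z : A)) = g₁ z
    rw [idemIdeal_hom_apply hf.1 g₂, ← mul_assoc a, ← ha, ← idemIdeal_hom_apply hf.1 g₁]
    exact (mem_idemIdeal he₁.1).1 (g₁ z).2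
  have hψr : LinearMap.range ψ ≤ LinearMap.range g₁ := by
    rw [hg₁]
    refine hu₁.le_jacobson fun ht => ?_
    have hs := LinearMap.range_eq_top.1 ht
    exact hne.false (LinearEquiv.ofBijective ψ ⟨hu₂.injective_of_surjective hs, hs⟩)
  obtain ⟨β, hβ⟩ := Module.projective_lifting_property g₁.rangeRestrict
    (ψ.codRestrict (LinearMap.range g₁) fun x => hψr ⟨x, rfl⟩) g₁.surjective_rangeRestrict
  have hcomp : g₁.rangeRestrict ∘ₗ (β ∘ₗ g₂) = g₁.rangeRestrict := by
    rw [← LinearMap.comp_assoc, hβ]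
    ext z
    exact congrArg Subtype.val (LinearMap.congr_fun hψ z)
  have hnt : Nontrivial (LinearMap.range g₁) :=
    Submodule.nontrivial_iff_ne_bot.2 (by rwa [hg₁])
  have hs : Function.Surjective (β ∘ₗ g₂) :=
    huf.surjective_of_comp (T := LinearMap.range g₁) (g := g₁.rangeRestrict) (by
      rw [hcomp]
      exact g₁.surjective_rangeRestrict)
  apply jacobson_ne_top (R := Aᵐᵒᵖ) (P := idemIdeal f)
  rw [eq_top_iff, ← LinearMap.range_eq_top.2 hs, LinearMap.range_comp, hg₂]
  exact Module.map_jacobson_le β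

/-- The images of `f` under `g₁` and `g₂` both lie in the uniserial left module `Af`, so one is a
left multiple of the other. This is where the left half of the Nakayama condition enters. -/
theorem not_range_eq_jacobson {e₁ e₂ f : A} (he₁ : IsPrimitiveIdempotent e₁)
    (he₂ : IsPrimitiveIdempotent e₂) (hf : IsPrimitiveIdempotent f) (hnak : IsNakayama A)
    (hne : IsEmpty (idemIdeal e₂ ≃ₗ[Aᵐᵒᵖ] idemIdeal e₁))
    {g₁ : idemIdeal f →ₗ[Aᵐᵒᵖ] idemIdeal e₁} {g₂ : idemIdeal f →ₗ[Aᵐᵒᵖ] idemIdeal e₂}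
    (hg₁ : LinearMap.range g₁ = Module.jacobson Aᵐᵒᵖ (idemIdeal e₁))
    (h₁ : Module.jacobson Aᵐᵒᵖ (idemIdeal e₁) ≠ ⊥)
    (h₂ : Module.jacobson Aᵐᵒᵖ (idemIdeal e₂) ≠ ⊥) :
    LinearMap.range g₂ ≠ Module.jacobson Aᵐᵒᵖ (idemIdeal e₂) := by
  intro hg₂
  rcases hf.left_mul_comparable hnak.1
    (idemIdeal_hom_apply hf.1 g₁ ⟨f, self_mem_idemIdeal hf.1⟩).symm
    (idemIdeal_hom_apply hf.1 g₂ ⟨f, self_mem_idemIdeal hf.1⟩).symm with ⟨a, ha⟩ | ⟨a, ha⟩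
  · exact ne_mul_of_range_eq_jacobson he₁ he₂ hf hnak.2 hne hg₁ hg₂ h₁ a ha
  · exact ne_mul_of_range_eq_jacobson he₂ he₁ hf hnak.2 ⟨fun φ => hne.false φ.symm⟩
      hg₂ hg₁ h₂ a ha

/-- Sending `i` to the top of `e i A` is a bijection onto the isomorphism classes of simple modules:
injective by basicness, surjective because every simple module is a quotient of some `e i A`. -/
theorem card_eq_numSimples {ι : Type u} [Fintype ι] {e : ι → A}
    (he : CompleteOrthogonalIdempotents e) (hp : ∀ i, IsPrimitiveIdempotent (e i))
    (hbasic : IsBasic A) (hnak : HasUniserialProjectives Aᵐᵒᵖ) :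
    Fintype.card ι = numSimples A := by
  have hu : ∀ i, IsUniserial Aᵐᵒᵖ (idemIdeal (e i)) := fun i => (hp i).isUniserial hnak
  have hproj : ∀ i, Module.Projective Aᵐᵒᵖ (idemIdeal (e i)) := fun i =>
    idemIdeal_projective (hp i).1
  have hnt : ∀ i, Nontrivial (idemIdeal (e i)) := fun i => (hp i).nontrivial
  have hsimple : ∀ I : {I : Submodule Aᵐᵒᵖ A // IsCoatom I}, IsSimpleModule Aᵐᵒᵖ (A ⧸ I.1) :=
    fun I => isSimpleModule_iff_isCoatom.2 I.2
  have hex : ∀ i, ∃ I : {I : Submodule Aᵐᵒᵖ A // IsCoatom I},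
      ∃ f : idemIdeal (e i) →ₗ[Aᵐᵒᵖ] A ⧸ I.1, Function.Surjective f := by
    intro i
    have : IsSimpleModule Aᵐᵒᵖ (idemIdeal (e i) ⧸ Module.jacobson Aᵐᵒᵖ (idemIdeal (e i))) :=
      isSimpleModule_iff_isCoatom.2 (hu i).isCoatom_jacobson
    let q : A →ₗ[Aᵐᵒᵖ] idemIdeal (e i) ⧸ Module.jacobson Aᵐᵒᵖ (idemIdeal (e i)) :=
      Submodule.mkQ _ ∘ₗ idemProj (e i)
    have hq : Function.Surjective q :=
      (Submodule.mkQ_surjective _).comp idemProj_surjective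
    let φ := q.quotKerEquivOfSurjective hq
    exact ⟨⟨LinearMap.ker q, isSimpleModule_iff_isCoatom.1 (IsSimpleModule.congr φ)⟩,
      φ.symm.toLinearMap ∘ₗ Submodule.mkQ _,
      φ.symm.surjective.comp (Submodule.mkQ_surjective _)⟩
  choose I f hf using hex
  let F : ι → Quotient (simpleSetoid A) := fun i => Quotient.mk _ (I i)
  rw [numSimples, ← Nat.card_eq_fintype_card]
  refine Nat.card_congr (Equiv.ofBijective F ⟨fun i j hij => ?_, fun x => ?_⟩)
  · obtain ⟨φ⟩ : Nonempty ((A ⧸ (I i).1) ≃ₗ[Aᵐᵒᵖ] (A ⧸ (I j).1)) := Quotient.exact hij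
    by_contra hne
    have := IsSimpleModule.nontrivial Aᵐᵒᵖ (A ⧸ (I j).1)
    obtain ⟨θ⟩ := (hu i).nonempty_equiv (hu j) (f := φ.toLinearMap ∘ₗ f i)
      (φ.surjective.comp (hf i)) (hf j)
    exact (isEmpty_equiv_of_orthogonal hbasic (hp i) (hp j) (he.ortho hne)
      (he.ortho (Ne.symm hne))).false θ
  · induction x using Quotient.inductionOn with
    | h I' =>
      obtain ⟨i, g, hg⟩ := exists_surjective_of_complete he.complete (A ⧸ I'.1)
      refine ⟨i, Quotient.sound ⟨?_⟩⟩
      exact ((f i).quotKerEquivOfSurjective (hf i)).symm.trans <|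
        (Submodule.quotEquivOfEq _ _ (by
          rw [(hu i).ker_eq_jacobson (hf i), (hu i).ker_eq_jacobson hg])).trans
        (g.quotKerEquivOfSurjective hg)

theorem exists_isKupischOrdering [IsArtinianRing Aᵐᵒᵖ] {ι : Type u} [Fintype ι] {e : ι → A}
    (he : CompleteOrthogonalIdempotents e) (hp : ∀ i, IsPrimitiveIdempotent (e i))
    (hbasic : IsBasic A) (hnak : IsNakayama A) (n : ℕ) [NeZero n] (hn : numSimples A = n)
    (S : Type u) [AddCommGroup S] [Module Aᵐᵒᵖ S] [IsSimpleModule Aᵐᵒᵖ S]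
    (hS : projDim A S = ⊤)
    (hT : ∀ (T : Type u) [AddCommGroup T] [Module Aᵐᵒᵖ T] [IsSimpleModule Aᵐᵒᵖ T],
      IsEmpty (T ≃ₗ[Aᵐᵒᵖ] S) → projDim A T = 1) :
    ∃ e : Fin n → A, IsKupischOrdering A e := by
  have hu : ∀ i, IsUniserial Aᵐᵒᵖ (idemIdeal (e i)) := fun i => (hp i).isUniserial hnak.2
  have hproj : ∀ i, Module.Projective Aᵐᵒᵖ (idemIdeal (e i)) := fun i =>
    idemIdeal_projective (hp i).1
  have hnt : ∀ i, Nontrivial (idemIdeal (e i)) := fun i => (hp i).nontrivial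
  have hSn : Nontrivial S := IsSimpleModule.nontrivial Aᵐᵒᵖ S
  have h0 : ∀ i, Module.jacobson Aᵐᵒᵖ (idemIdeal (e i)) ≠ ⊥ := fun i =>
    jacobson_ne_bot hS hT (hu i)
  have hne : ∀ i j, i ≠ j → IsEmpty (idemIdeal (e i) ≃ₗ[Aᵐᵒᵖ] idemIdeal (e j)) := fun i j hij =>
    isEmpty_equiv_of_orthogonal hbasic (hp i) (hp j) (he.ortho hij) (he.ortho hij.symm)
  choose σ g hg using fun i =>
    exists_index_range_eq_jacobson he.complete (fun i => (hp i).1) (hu i) (h0 i)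
  have hinj : Function.Injective σ := by
    intro i j hij
    by_contra hc
    -- The index `k` is kept free so that `g j`, whose type mentions `σ j`, can be used at `σ i`.
    have key : ∀ k, k = σ i → ∀ g' : idemIdeal (e k) →ₗ[Aᵐᵒᵖ] idemIdeal (e j),
        LinearMap.range g' ≠ Module.jacobson Aᵐᵒᵖ (idemIdeal (e j)) := by
      rintro k rfl g'
      exact not_range_eq_jacobson (hp i) (hp j) (hp _) hnak (hne j i (Ne.symm hc)) (hg i)
        (h0 i) (h0 j)
    exact key _ hij.symm (g j) (hg j)
  let τ : Equiv.Perm ι := Equiv.ofBijective σ (Finite.injective_iff_bijective.1 hinj)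
  obtain ⟨s, f, hf⟩ := exists_surjective_of_complete he.complete S
  -- For `i ≠ s`, `e (σ i) A` is isomorphic to the radical of `e i A`, so the length drops strictly
  -- and the walk must end at `s`.
  have hreach : ∀ i, ∃ m : ℕ, (τ ^ m) i = s := by
    intro i
    induction hm : Module.length Aᵐᵒᵖ (idemIdeal (e i)) using WellFoundedLT.induction
      generalizing i with
    | ind m ih =>
      by_cases his : i = s
      · exact ⟨0, his⟩
      have : Module.Projective Aᵐᵒᵖ (Module.jacobson Aᵐᵒᵖ (idemIdeal (e i))) := by
        refine jacobson_projective hT (hu i) fun f' hf' => ?_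
        obtain ⟨φ⟩ := (hu i).nonempty_equiv (hu s) hf' hf
        exact (hne i s his).false φ
      obtain ⟨φ⟩ := exists_equiv_jacobson (hu _) (h0 i) (hg i)
      obtain ⟨k, hk⟩ := ih _
        (by
          rw [← hm, LinearEquiv.length_eq (N := Module.jacobson Aᵐᵒᵖ (idemIdeal (e i))) φ]
          exact Submodule.length_lt jacobson_ne_top) (σ i) rfl
      exact ⟨k + 1, by rw [pow_succ]; exact hk⟩
  obtain ⟨φ, hφ⟩ := exists_fin_equiv_of_reach τ s hreach n
    ((card_eq_numSimples he hp hbasic hnak.2).trans hn)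
  refine ⟨e ∘ φ, ⟨⟨fun i => he.idem _, fun i j hij => he.ortho (φ.injective.ne hij)⟩, ?_⟩,
    fun i => hp _, fun i => ?_⟩
  · exact (Equiv.sum_comp φ e).trans he.complete
  · have key : ∀ j, j = σ (φ i) →
        ∃ p : idemIdeal (e j) →ₗ[Aᵐᵒᵖ] idemRad (e (φ i)), IsProjectiveCover p := by
      rintro _ rfl
      exact exists_isProjectiveCover (hp _).1 (hp _).1 (hu _) (hg (φ i)) (h0 _)
    exact key _ (hφ i)

end Quiver
theorem exists_completeOrthogonal_primitive {K : Type v} {A : Type u} [Field K]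
    [Ring A] [Algebra K A] [FiniteDimensional K A] :
    ∃ s : Finset A, CompleteOrthogonalIdempotents (fun x : s => (x : A)) ∧
      ∀ x : s, IsPrimitiveIdempotent (x : A) := by
  obtain ⟨s, hs, hso, hse⟩ := exists_orthogonal_primitive (K := K) (1 : A) IsIdempotentElem.one
  exact ⟨s, ⟨⟨fun x => (hs x x.2).1, fun x y hxy => hso x x.2 y y.2 (by simpa using hxy)⟩,
    by rw [← hse]; exact Finset.sum_coe_sort s id⟩, fun x => hs x x.2⟩

end NakayamaKupisch

/-! ### The classification of Kupisch series. -/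

theorem proposition3p3 (K : Type v) (A : Type u) [Field K] [Ring A] [Algebra K A]
    [FiniteDimensional K A]
    (hbasic : NakayamaKupisch.IsBasic A)
    (hconn : NakayamaKupisch.IsConnectedRing A)
    (hnak : NakayamaKupisch.IsNakayama A)
    (hself : ¬ NakayamaKupisch.IsSelfinjective A)
    (n : ℕ) [NeZero n] (hn : NakayamaKupisch.numSimples A = n)
    (S : Type u) [AddCommGroup S] [Module Aᵐᵒᵖ S] [IsSimpleModule Aᵐᵒᵖ S]
    (hS : NakayamaKupisch.projDim A S = ⊤)
    (hT : ∀ (T : Type u) [AddCommGroup T] [Module Aᵐᵒᵖ T] [IsSimpleModule Aᵐᵒᵖ T],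
      IsEmpty (T ≃ₗ[Aᵐᵒᵖ] S) → NakayamaKupisch.projDim A T = 1) :
    ∃ k q : ℕ, ((2 ≤ k ∧ k ≤ n ∧ 1 ≤ q) ∨ k = n + 1) ∧
      NakayamaKupisch.IsKupischSeries A (NakayamaKupisch.standardSeries n k q) ∧
      ∀ c : Fin n → ℕ, NakayamaKupisch.IsKupischSeries A c →
        ∃ r : Fin n, ∀ i : Fin n, c (i + r) = NakayamaKupisch.standardSeries n k q i := by
  have : IsArtinianRing Aᵐᵒᵖ := IsArtinianRing.of_finite K Aᵐᵒᵖ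
  obtain ⟨t, ht, htp⟩ := NakayamaKupisch.exists_completeOrthogonal_primitive (K := K) (A := A)
  obtain ⟨e, he⟩ := NakayamaKupisch.exists_isKupischOrdering ht htp hbasic hnak n hn S hS hT
  have hlen : ∀ i, ∃ m : ℕ, Module.length Aᵐᵒᵖ (NakayamaKupisch.idemIdeal (e i)) = m := fun i =>
    ⟨_, (ENat.natCast_toNat Module.length_ne_top).symm⟩
  choose c hc using hlen
  obtain ⟨s, ⟨f, hf⟩, hs, hsucc⟩ := he.exists_length_eq hc hbasic hnak S hS hT
  obtain ⟨k, q, hkq, hcs⟩ := NakayamaKupisch.exists_standard_parameters (NeZero.ne n) hs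
  refine ⟨k, q, hkq, ⟨fun i => e (i + s), he.add_right s, fun i => ?_⟩, ?_⟩
  · rw [← NakayamaKupisch.eq_standardSeries hsucc hcs, hc]
  · rintro c' ⟨e', he', hc'⟩
    obtain ⟨s', ⟨f', hf'⟩, -, hsucc'⟩ := he'.exists_length_eq hc' hbasic hnak S hS hT
    refine ⟨s', NakayamaKupisch.eq_standardSeries hsucc' ?_⟩
    have := NakayamaKupisch.idemIdeal_projective (he.primitive s).1
    have := NakayamaKupisch.idemIdeal_projective (he'.primitive s').1
    have := IsSimpleModule.nontrivial Aᵐᵒᵖ S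
    -- Both projectives cover `S`, so they are isomorphic and `c' s' = c s`; this one value fixes
    -- the rest of `c'`.
    obtain ⟨φ⟩ := ((he'.primitive s').isUniserial hnak.2).nonempty_equiv
      ((he.primitive s).isUniserial hnak.2) hf' hf
    have h := φ.length_eq
    rw [hc, hc', hcs] at h
    exact_mod_cast h
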